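/- Let $\sigma_x,\sigma_z$ be the Pauli matrices. For $\varphi\in\mathbb R$ and $x\in[-1,1]$ let $$U_{\varphi,x}=e^{i\varphi\sigma_z/2}\,e^{i\arccos(x)\,\sigma_x}\,e^{-i\varphi\sigma_z/2}$$ (a twisted embeddable unitary). Consider circuits on three qubits: a target qubit $t_1$ and two ancilla qubits $c$ and $t_2$, of which $c$ serves as the control of the gate to be implemented. A circuit is a finite sequence of the following steps: an uncontrolled query, i.e. an application of the oracle $U$ to one of the qubits; a CSWAP gate with control $c$ that swaps $t_1$ and $t_2$; a fixed (independent of $U$) single-qubit unitary on one of the qubits; a fixed single-qubit unitary on $t_1$ or $t_2$ controlled by $c$. There is a universal constant $C>0$ such that for all $\delta\in(0,1]$ and $\varepsilon\in(0,1]$ there is such a circuit, depending only on $\delta$ and $\varepsilon$, which makes $$\zeta\le C\,\delta^{-1}\log\frac{1}{\varepsilon\delta}=\widetilde{\mathcal O}\bigl(\delta^{-1}\log(\varepsilon^{-1})\bigr)$$ queries to $U$ and which, for every $\varphi\in\mathbb R$ and every $x\in[\delta,1-\delta]$, when run with the oracle $U=U_{\varphi,x}$, implements an $8\times 8$ unitary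 $V$ with $$\bigl\|\,V-\bigl(|0\rangle\langle 0|_c\otimes I_{t_1}+|1\rangle\langle 1|_c\otimes [e^{-i\varphi\sigma_z}]_{t_1}\bigr)\otimes I_{t_2}\bigr\|\le\varepsilon$$ in spectral norm; that is, an $\varepsilon$-approximation of the controlled-$e^{-i\varphi\sigma_z}$ gate. -/

import Mathlib

open scoped Kronecker

namespace QCircuit

/-- The Pauli matrix `σ_x`. -/
def sigmaX : Matrix (Fin 2) (Fin 2) ℂ := !![0, 1; 1, 0]

/-- The Pauli matrix `σ_z`. -/
def sigmaZ : Matrix (Fin 2) (Fin 2) ℂ := !![1, 0; 0, -1]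

/-- The rotation `e^{i t σ_x}`. -/
noncomputable def rotX (t : ℝ) : Matrix (Fin 2) (Fin 2) ℂ :=
  NormedSpace.exp ((Complex.I * (t : ℂ)) • sigmaX)

/-- The rotation `e^{i t σ_z}`. -/
noncomputable def rotZ (t : ℝ) : Matrix (Fin 2) (Fin 2) ℂ :=
  NormedSpace.exp ((Complex.I * (t : ℂ)) • sigmaZ)

/-- The twisted embeddable unitary `e^{i φ σ_z / 2} e^{i θ σ_x} e^{-i φ σ_z / 2}`. -/
noncomputable def twisted (φ θ : ℝ) : Matrix (Fin 2) (Fin 2) ℂ :=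
  rotZ (φ / 2) * rotX θ * rotZ (-(φ / 2))

/-- Computational basis labels of the three-qubit register; the components are, in this order,
the qubits `c`, `t₁`, `t₂`. -/
abbrev Basis3 : Type := Fin 2 × Fin 2 × Fin 2

/-- Operators on the three-qubit register. -/
abbrev Op3 : Type := Matrix Basis3 Basis3 ℂ

/-- The three qubits: the control `c`, the target `t₁` and the work qubit `t₂`. -/
inductive Qubit where
  | c
  | t₁
  | t₂

/-- The single-qubit operator `A` acting on the given qubit of the register. -/
def onQubit : Qubit → Matrix (Fin 2) (Fin 2) ℂ → Op3
  | .c, A => A ⊗ₖ ((1 : Matrix (Fin 2) (Fin 2) ℂ) ⊗ₖ (1 : Matrix (Fin 2) (Fin 2) ℂ))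
  | .t₁, A => (1 : Matrix (Fin 2) (Fin 2) ℂ) ⊗ₖ (A ⊗ₖ (1 : Matrix (Fin 2) (Fin 2) ℂ))
  | .t₂, A => (1 : Matrix (Fin 2) (Fin 2) ℂ) ⊗ₖ ((1 : Matrix (Fin 2) (Fin 2) ℂ) ⊗ₖ A)

/-- The projector `|b⟩⟨b|` on the qubit `c`. -/
def projC (b : Fin 2) : Op3 := onQubit .c (Matrix.single b b 1)

/-- The two qubits that a gate controlled by `c` may act on. -/
inductive Target where
  | t₁
  | t₂

/-- A target, as a qubit of the register. -/
def Target.toQubit : Target → Qubit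
  | .t₁ => .t₁
  | .t₂ => .t₂

/-- The gate `|0⟩⟨0|_c ⊗ I + |1⟩⟨1|_c ⊗ [A]_q`: the operator `A` on `q`, controlled by `c`. -/
def controlled (q : Target) (A : Matrix (Fin 2) (Fin 2) ℂ) : Op3 :=
  projC 0 + projC 1 * onQubit q.toQubit A

/-- The action of the CSWAP gate on basis labels: swap `t₁` and `t₂` if `c` is `1`. -/
def cswapLabel (j : Basis3) : Basis3 :=
  if j.1 = 1 then (j.1, j.2.2, j.2.1) else j

/-- The CSWAP (Fredkin) gate with control `c` and swapped qubits `t₁`, `t₂`. -/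
def cswap : Op3 := Matrix.of fun i j => if i = cswapLabel j then 1 else 0

/-- The elementary steps of a circuit with oracle access to a single-qubit unitary `U`: an
uncontrolled query, applying `U` to one of the qubits; a CSWAP gate; a fixed single-qubit gate;
and a fixed single-qubit gate controlled by `c`. Only the first kind involves `U`. -/
inductive Gate where
  | query (q : Qubit)
  | cswap
  | fixed (q : Qubit) (A : Matrix.unitaryGroup (Fin 2) ℂ)
  | ctrlFixed (q : Target) (A : Matrix.unitaryGroup (Fin 2) ℂ)

/-- The operator of a gate when the oracle is `U`. -/
def Gate.eval (U : Matrix (Fin 2) (Fin 2) ℂ) : Gate → Op3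
  | .query q => onQubit q U
  | .cswap => QCircuit.cswap
  | .fixed q A => onQubit q (A : Matrix (Fin 2) (Fin 2) ℂ)
  | .ctrlFixed q A => controlled q (A : Matrix (Fin 2) (Fin 2) ℂ)

/-- Number of oracle queries made by a gate. -/
def Gate.queries : Gate → ℕ
  | .query _ => 1
  | .cswap => 0
  | .fixed _ _ => 0
  | .ctrlFixed _ _ => 0

/-- A circuit: a finite sequence of gates, written as an operator product (the last gate of the
list acts first). -/
abbrev Circuit : Type := List Gate

/-- The three-qubit operator implemented by a circuit when the oracle is `U`. -/
def Circuit.eval (U : Matrix (Fin 2) (Fin 2) ℂ) (P : Circuit) : Op3 :=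
  (List.map (Gate.eval U) P).prod

/-- The number of queries to the oracle made by a circuit. -/
def Circuit.queries (P : Circuit) : ℕ :=
  (List.map Gate.queries P).sum

/-- The spectral norm, that is, the operator norm for the Hilbert space norm. -/
noncomputable def opNorm (A : Op3) : ℝ :=
  ‖Matrix.toEuclideanCLM (n := Basis3) (𝕜 := ℂ) A‖

end QCircuit

/-! The oracle is the matrix with diagonal `cos θ` and off-diagonal entry `i sin θ e^{iφ}`, where `x
= cos θ`. Quantum signal processing with phases independent of `φ` and `θ` (`exists_phases`)
produces a matrix with upper right entry `i F e^{iφ}`, where `F` is a polynomial in `cos θ` times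
`sin θ`. If `F` is close to `1`, multiplication by `-iσ_x` turns this into approximately
`e^{-iφσ_z}`.

A suitable `F` is an odd approximation of the sign function evaluated at `sin 2θ`, since `sin 2θ ≥
δ` on the given range of `x`. Its degree is `O(δ⁻¹ log (1/(εδ)))` (`exists_odd_sign_approx`). The
complementary diagonal entry comes from writing a nonnegative real polynomial as a squared modulus
(`exists_map_eq_mul_map_conj`).

The queries themselves are never controlled. Since `σ_z U σ_z = U⁻¹`, the product `U σ_z` is an
involution (`twisted_mul_sigmaZ_sq`). Controlling only the fixed gates makes the branch `c = 0` run
an even power of `U σ_z`, which is the identity, while `c = 1` runs the sequence. Neither CSWAP nor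
`t₂` is needed. -/

open Polynomial

/-! ### Odd polynomial approximation of the sign function -/

namespace Polynomial

/-- Every polynomial in `s ^ 2` has an odd primitive. -/
theorem exists_odd_primitive (κ : ℝ[X]) :
    ∃ g : ℝ[X], g.natDegree ≤ κ.natDegree ∧
      derivative (X * g.comp (X ^ 2)) = κ.comp (X ^ 2) := by
  refine ⟨∑ k ∈ Finset.range (κ.natDegree + 1), C (κ.coeff k / (2 * k + 1)) * X ^ k, ?_, ?_⟩
  · refine natDegree_sum_le_of_forall_le _ _ fun k hk => ?_
    exact (natDegree_C_mul_X_pow_le _ _).trans (Finset.mem_range_succ_iff.1 hk)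
  · conv_rhs => rw [κ.as_sum_range_C_mul_X_pow]
    simp only [sum_comp, Finset.mul_sum, derivative_sum, mul_comp, C_comp, pow_comp, X_comp]
    refine Finset.sum_congr rfl fun k _ => ?_
    have h : (X : ℝ[X]) * (C (κ.coeff k / (2 * k + 1)) * (X ^ 2) ^ k)
        = C (κ.coeff k / (2 * k + 1)) * X ^ (2 * k + 1) := by ring
    rw [h, derivative_C_mul_X_pow, ← pow_mul]
    congr 2
    have : (2 * (k : ℝ) + 1) ≠ 0 := by positivity
    push_cast
    field_simp

theorem half_exp_le_eval_T_cosh (m : ℕ) (t : ℝ) :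
    Real.exp (m * t) / 2 ≤ (Chebyshev.T ℝ m).eval (Real.cosh t) := by
  rw [Chebyshev.T_real_cosh, Real.cosh_eq]
  have := Real.exp_pos (-(m * t))
  push_cast
  linarith

/-- Writing `y = cosh t`, it suffices that `t ≥ δ`. This follows from `cosh δ ≤ e^{δ²/2} ≤ 1/(1 -
δ²/2) ≤ 1 + δ²`. -/
theorem half_exp_le_eval_T (m : ℕ) {δ y : ℝ} (hδ : 0 ≤ δ) (hδ1 : δ ≤ 1) (hy : 1 + δ ^ 2 ≤ y) :
    Real.exp (m * δ) / 2 ≤ (Chebyshev.T ℝ m).eval y := by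
  have h1 : (1 : ℝ) ≤ y := by nlinarith
  have hc : Real.cosh δ ≤ y := by
    refine (Real.cosh_le_exp_half_sq δ).trans (le_trans ?_ hy)
    have := Real.exp_bound_div_one_sub_of_interval (x := δ ^ 2 / 2) (by positivity) (by nlinarith)
    refine this.trans ?_
    rw [div_le_iff₀ (by nlinarith)]
    nlinarith [sq_nonneg δ, mul_nonneg (sq_nonneg δ) (sub_nonneg.2 (pow_le_one₀ hδ hδ1 : δ ^ 2 ≤ 1))]
  have hy' : Real.cosh (Real.arcosh y) = y := Real.cosh_arcosh h1
  have hle : δ ≤ Real.arcosh y := by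
    rw [← hy', Real.cosh_le_cosh, abs_of_nonneg hδ, abs_of_nonneg (Real.arcosh_nonneg h1)] at hc
    exact hc
  rw [← hy']
  refine le_trans ?_ (half_exp_le_eval_T_cosh m _)
  gcongr

/-- An odd polynomial approximation of the sign function on `[δ, 1]`, bounded by `1`. -/
theorem exists_odd_sign_approx (m : ℕ) {δ η : ℝ} (hδ : 0 < δ) (hδ1 : δ ≤ 1 / 2)
    (hm : 8 ≤ Real.exp (2 * m * δ) * (δ * η)) (hη : 0 < η) :
    ∃ g : ℝ[X], g.natDegree ≤ 2 * m ∧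
      (∀ s : ℝ, 0 ≤ s → s ≤ 1 → 0 ≤ s * g.eval (s ^ 2) ∧ s * g.eval (s ^ 2) ≤ 1) ∧
      ∀ s : ℝ, δ ≤ s → s ≤ 1 → 1 - η ≤ s * g.eval (s ^ 2) := by
  have hd2 : 0 < 1 - δ ^ 2 := by nlinarith
  -- The affine map sending `[δ², 1]` onto `[-1, 1]` with `δ² ↦ 1`. The kernel `κ(s²)` is then at
  -- most `1` for `s` in `[δ, 1]` and exponentially large for `s` in `[0, δ/2]`, so almost all the
  -- growth of its primitive `G` happens before `δ`.
  set l : ℝ[X] := C (1 + 2 * δ ^ 2 / (1 - δ ^ 2)) - C (2 / (1 - δ ^ 2)) * X with hl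
  set κ : ℝ[X] := ((Chebyshev.T ℝ m).comp l) ^ 2 with hκ
  have hle (v : ℝ) : l.eval v = 1 + 2 * (δ ^ 2 - v) / (1 - δ ^ 2) := by
    simp only [hl, eval_sub, eval_C, eval_mul, eval_X]
    ring
  have hκe (v : ℝ) : κ.eval v = ((Chebyshev.T ℝ m).eval (l.eval v)) ^ 2 := by
    simp [hκ, eval_comp]
  have hκ0 (v : ℝ) : 0 ≤ κ.eval v := by rw [hκe]; positivity
  have hκ1 (v : ℝ) (h1 : δ ^ 2 ≤ v) (h2 : v ≤ 1) : κ.eval v ≤ 1 := by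
    rw [hκe, sq_le_one_iff_abs_le_one]
    apply Chebyshev.abs_eval_T_real_le_one
    rw [hle, abs_le]
    constructor
    · have : -2 ≤ 2 * (δ ^ 2 - v) / (1 - δ ^ 2) := by
        rw [le_div_iff₀ hd2]; linarith
      linarith
    · have : 2 * (δ ^ 2 - v) / (1 - δ ^ 2) ≤ 0 :=
        div_nonpos_of_nonpos_of_nonneg (by linarith) hd2.le
      linarith
  set M : ℝ := Real.exp (2 * m * δ) / 4 with hM
  have hM0 : 0 < M := by positivity
  have hκM (v : ℝ) (h1 : v ≤ (δ / 2) ^ 2) : M ≤ κ.eval v := by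
    have h : Real.exp (m * δ) / 2 ≤ (Chebyshev.T ℝ m).eval (l.eval v) := by
      apply half_exp_le_eval_T m hδ.le (by linarith)
      rw [hle]
      gcongr
      rw [le_div_iff₀ hd2]
      nlinarith
    rw [hκe, hM]
    calc Real.exp (2 * m * δ) / 4 = (Real.exp (m * δ) / 2) ^ 2 := by
          rw [div_pow, ← Real.exp_nat_mul]; norm_num; ring_nf
      _ ≤ _ := by gcongr
  obtain ⟨g, hgd, hg⟩ := exists_odd_primitive κ
  set G : ℝ[X] := X * g.comp (X ^ 2) with hG
  have hGe (s : ℝ) : G.eval s = s * g.eval (s ^ 2) := by simp [hG, eval_comp]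
  have hder (s : ℝ) : deriv (fun s => G.eval s) s = κ.eval (s ^ 2) := by
    rw [Polynomial.deriv, hg]; simp [eval_comp]
  have hmono : Monotone fun s => G.eval s :=
    monotone_of_deriv_nonneg G.differentiable fun s => by rw [hder]; exact hκ0 _
  have hG0 : G.eval 0 = 0 := by simp [hGe]
  have hlow : M * (δ / 2) ≤ G.eval (δ / 2) := by
    have := (convex_Icc (0 : ℝ) (δ / 2)).mul_sub_le_image_sub_of_le_deriv
      (f := fun s => G.eval s) (C := M) G.continuous.continuousOn G.differentiable.differentiableOn
      (fun s hs => by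
        rw [interior_Icc] at hs
        rw [hder]
        exact hκM _ (pow_le_pow_left₀ hs.1.le hs.2.le 2))
      0 ⟨le_rfl, by linarith⟩ (δ / 2) ⟨by linarith, le_rfl⟩ (by linarith)
    simpa [hG0] using this
  have hup : G.eval 1 - G.eval δ ≤ 1 := by
    have := (convex_Icc δ 1).image_sub_le_mul_sub_of_deriv_le
      (f := fun s => G.eval s) (C := 1) G.continuous.continuousOn G.differentiable.differentiableOn
      (fun s hs => by
        rw [interior_Icc] at hs
        rw [hder]
        exact hκ1 _ (pow_le_pow_left₀ hδ.le hs.1.le 2) (pow_le_one₀ (hδ.le.trans hs.1.le) hs.2.le))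
      δ ⟨le_rfl, by linarith⟩ 1 ⟨by linarith, le_rfl⟩ (by linarith)
    have h' : G.eval 1 - G.eval δ ≤ 1 * (1 - δ) := this
    linarith
  have hG1 : M * (δ / 2) ≤ G.eval 1 := hlow.trans (hmono (by linarith))
  have hG1p : 0 < G.eval 1 := lt_of_lt_of_le (by positivity) hG1
  have hfin (s : ℝ) : s * (C (G.eval 1)⁻¹ * g).eval (s ^ 2) = G.eval s / G.eval 1 := by
    rw [eval_mul, eval_C, hGe s]; ring
  refine ⟨C (G.eval 1)⁻¹ * g, ?_, ?_, ?_⟩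
  · refine (natDegree_C_mul_le _ _).trans (hgd.trans ?_)
    rw [hκ]
    refine natDegree_pow_le.trans ?_
    rw [natDegree_comp, Chebyshev.natDegree_T, Int.natAbs_natCast]
    have : l.natDegree ≤ 1 := by
      rw [hl]; compute_degree
    nlinarith
  · intro s hs0 hs1
    rw [hfin]
    constructor
    · apply div_nonneg _ hG1p.le
      rw [← hG0]; exact hmono hs0
    · rw [div_le_one hG1p]; exact hmono hs1
  · intro s hs0 hs1
    rw [hfin, le_div_iff₀ hG1p]
    have h1 : G.eval δ ≤ G.eval s := hmono hs0
    -- The `8` in `hm` is the product of the `4` in `M` and the `2` in `δ / 2`. As `G` grows by at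
    -- most `1` on `[δ, 1]`, the relative loss there is at most `1 / G(1) ≤ η`.
    have h2 : 1 ≤ η * G.eval 1 := by
      calc 1 ≤ Real.exp (2 * m * δ) * (δ * η) / 8 := by linarith
        _ = η * (M * (δ / 2)) := by rw [hM]; ring
        _ ≤ _ := by gcongr
    linarith

end Polynomial

/-! ### Nonnegative real polynomials as squared moduli -/

namespace Polynomial

/-- A real polynomial that is nonnegative on the real line is the squared modulus of a complex
polynomial. -/
theorem exists_map_eq_mul_map_conj (B : ℝ[X]) (hB : ∀ x, 0 ≤ B.eval x) :
    ∃ P : ℂ[X], B.map Complex.ofRealHom = P * P.map (starRingEnd ℂ) := by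
  induction hn : B.natDegree using Nat.strong_induction_on generalizing B with
  | _ n ih =>
  by_cases h0 : B.natDegree = 0
  · obtain ⟨b, rfl⟩ := natDegree_eq_zero.1 h0
    have hb : 0 ≤ b := by simpa using hB 0
    refine ⟨C (Real.sqrt b : ℂ), ?_⟩
    simp only [map_C, Complex.ofRealHom_eq_coe, Complex.conj_ofReal, ← C_mul]
    rw [← Complex.ofReal_mul, Real.mul_self_sqrt hb]
  have hdeg : B.degree ≠ 0 := fun h => h0 (natDegree_eq_of_degree_eq_some h)
  have hB0 : B ≠ 0 := fun h => h0 (by simp [h])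
  obtain ⟨ζ, hζ⟩ := IsAlgClosed.exists_aeval_eq_zero ℂ B hdeg
  by_cases him : ζ.im = 0
  · obtain ⟨a, rfl⟩ : ∃ a : ℝ, (a : ℂ) = ζ := ⟨ζ.re, Complex.ext rfl (by simp [him])⟩
    have ha : B.eval a = 0 := by
      have h : aeval ((algebraMap ℝ ℂ) a) B = 0 := hζ
      rw [aeval_algebraMap_apply] at h
      simpa using h
    -- A real root is a minimum, hence a double root; the factor `(X - a)²` can be removed.
    have hmin : IsLocalMin (fun x => B.eval x) a :=
      Filter.Eventually.of_forall fun x => by simpa [ha] using hB x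
    have hd : B.derivative.eval a = 0 := by
      have := hmin.deriv_eq_zero
      rwa [Polynomial.deriv] at this
    obtain ⟨B₁, rfl⟩ := dvd_iff_isRoot.2 ha
    have h1 : B₁.eval a = 0 := by simpa [derivative_mul] using hd
    obtain ⟨B₂, rfl⟩ := dvd_iff_isRoot.2 h1
    have hne : ∀ x ≠ a, 0 ≤ B₂.eval x := fun x hx => by
      have := hB x
      simp only [eval_mul, eval_sub, eval_X, eval_C] at this
      rw [← mul_assoc, ← sq] at this
      exact nonneg_of_mul_nonneg_right this (by have := sub_ne_zero.2 hx; positivity)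
    -- Division by `(x - a)²` says nothing at `a` itself, where continuity decides.
    have hB2 : ∀ x, 0 ≤ B₂.eval x := by
      have hcl : IsClosed {x | 0 ≤ B₂.eval x} := isClosed_le continuous_const B₂.continuous
      have hden : Dense {x | 0 ≤ B₂.eval x} := (dense_compl_singleton a).mono hne
      intro x
      have : x ∈ closure {x | 0 ≤ B₂.eval x} := hden x
      rwa [hcl.closure_eq] at this
    have hB₂0 : B₂ ≠ 0 := by rintro rfl; simp at hB0
    obtain ⟨P, hP⟩ := ih B₂.natDegree (by
      rw [← hn, natDegree_mul (X_sub_C_ne_zero a) (mul_ne_zero (X_sub_C_ne_zero a) hB₂0),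
        natDegree_mul (X_sub_C_ne_zero a) hB₂0, natDegree_X_sub_C]
      omega) B₂ hB2 rfl
    refine ⟨(X - C (a : ℂ)) * P, ?_⟩
    simp only [Polynomial.map_mul, hP, Polynomial.map_sub, map_X, map_C, Complex.ofRealHom_eq_coe,
      Complex.conj_ofReal]
    ring
  · obtain ⟨B₁, hB₁⟩ := B.quadratic_dvd_of_aeval_eq_zero_im_ne_zero hζ him
    have hpos (x : ℝ) : 0 < x ^ 2 - 2 * ζ.re * x + ‖ζ‖ ^ 2 := by
      have h : ‖ζ‖ ^ 2 = ζ.re ^ 2 + ζ.im ^ 2 := by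
        rw [← Complex.normSq_eq_norm_sq, Complex.normSq_apply]; ring
      have : 0 < ζ.im ^ 2 := by positivity
      nlinarith [sq_nonneg (x - ζ.re)]
    have hB1 : ∀ x, 0 ≤ B₁.eval x := fun x => by
      have := hB x
      rw [hB₁] at this
      simp only [eval_mul, eval_add, eval_sub, eval_X, eval_C, eval_pow] at this
      exact nonneg_of_mul_nonneg_right this (hpos x)
    have hB₁0 : B₁ ≠ 0 := by rintro rfl; simp [hB₁] at hB0
    have hq : (X ^ 2 - C (2 * ζ.re) * X + C (‖ζ‖ ^ 2) : ℝ[X]).natDegree = 2 := by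
      compute_degree!
    obtain ⟨P, hP⟩ := ih B₁.natDegree (by
      rw [← hn, hB₁, natDegree_mul (fun h => by rw [h] at hq; simp at hq) hB₁0, hq]
      omega) B₁ hB1 rfl
    refine ⟨(X - C ζ) * P, ?_⟩
    rw [hB₁]
    have hs : (ζ : ℂ) + starRingEnd ℂ ζ = ((2 * ζ.re : ℝ) : ℂ) := Complex.add_conj ζ
    have hm : ζ * starRingEnd ℂ ζ = ((‖ζ‖ ^ 2 : ℝ) : ℂ) := by
      rw [Complex.mul_conj, Complex.normSq_eq_norm_sq]
    simp only [Polynomial.map_mul, hP, Polynomial.map_sub, Polynomial.map_add, Polynomial.map_pow,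
      map_X, map_C, Complex.ofRealHom_eq_coe]
    rw [← hs, ← hm, C_add, C_mul]
    ring

end Polynomial

/-! ### Matrix forms of the rotations and quantum signal processing -/

namespace QCircuit

open ComplexConjugate

/-- The matrix `[[p, q], [-q̄, p̄]]`. -/
noncomputable def su (p q : ℂ) : Matrix (Fin 2) (Fin 2) ℂ := !![p, q; -conj q, conj p]

theorem su_mul_su (a b c d : ℂ) :
    su a b * su c d = su (a * c - b * conj d) (a * d + b * conj c) := by
  ext i j
  fin_cases i <;> fin_cases j <;> simp [su, Matrix.mul_apply, Fin.sum_univ_two] <;> ring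

theorem rotZ_eq_su (t : ℝ) : rotZ t = su (Complex.exp (t * Complex.I)) 0 := by
  have h : (Complex.I * (t : ℂ)) • sigmaZ
      = Matrix.diagonal ![t * Complex.I, -(t * Complex.I)] := by
    ext i j
    fin_cases i <;> fin_cases j <;> simp [sigmaZ, mul_comm]
  rw [rotZ, h, Matrix.exp_diagonal]
  ext i j
  fin_cases i <;> fin_cases j <;>
    simp [su, Pi.coe_exp, ← Complex.exp_eq_exp_ℂ, ← Complex.exp_conj]

theorem rotX_eq_su (t : ℝ) : rotX t = su (Real.cos t) (Complex.I * Real.sin t) := by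
  -- Conjugation by the unnormalised Hadamard matrix exchanges `σ_x` and `σ_z`, reducing to the
  -- diagonal exponential.
  set H : Matrix (Fin 2) (Fin 2) ℂ := !![1, 1; 1, -1] with hH
  have hdet : IsUnit H := by
    rw [Matrix.isUnit_iff_isUnit_det]
    norm_num [hH, Matrix.det_fin_two]
  have hinv : H⁻¹ = !![1 / 2, 1 / 2; 1 / 2, -1 / 2] := by
    apply Matrix.inv_eq_right_inv
    ext i j
    fin_cases i <;> fin_cases j <;> norm_num [hH, Matrix.mul_apply, Fin.sum_univ_two]
  have h : (Complex.I * (t : ℂ)) • sigmaX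
      = H * ((Complex.I * (t : ℂ)) • sigmaZ) * H⁻¹ := by
    rw [hinv]
    ext i j
    fin_cases i <;> fin_cases j <;>
      simp [hH, sigmaX, sigmaZ, Matrix.mul_apply, Fin.sum_univ_two] <;> ring
  have hc : conj (Complex.cos t) = Complex.cos t := by rw [← Complex.cos_conj, Complex.conj_ofReal]
  have hs : conj (Complex.sin t) = Complex.sin t := by rw [← Complex.sin_conj, Complex.conj_ofReal]
  rw [rotX, h, Matrix.exp_conj _ _ hdet, ← rotZ, rotZ_eq_su, hinv]
  ext i j
  fin_cases i <;> fin_cases j <;>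
    simp [hH, su, Matrix.mul_apply, Fin.sum_univ_two, Complex.exp_mul_I, hc, hs] <;> ring

theorem twisted_eq_su (φ θ : ℝ) : twisted φ θ
    = su (Real.cos θ) (Complex.I * Real.sin θ * Complex.exp (φ * Complex.I)) := by
  have h1 : Complex.exp ((φ / 2 : ℝ) * Complex.I) * Complex.exp ((-(φ / 2) : ℝ) * Complex.I) = 1 := by
    rw [← Complex.exp_add, ← Complex.exp_zero]; congr 1; push_cast; ring
  have h2 : Complex.exp ((φ / 2 : ℝ) * Complex.I) * Complex.exp ((φ / 2 : ℝ) * Complex.I)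
      = Complex.exp (φ * Complex.I) := by
    rw [← Complex.exp_add]; congr 1; push_cast; ring
  have h3 : conj (Complex.exp ((-(φ / 2) : ℝ) * Complex.I))
      = Complex.exp ((φ / 2 : ℝ) * Complex.I) := by
    rw [← Complex.exp_conj, map_mul, Complex.conj_ofReal, Complex.conj_I]
    congr 1; push_cast; ring
  rw [twisted, rotZ_eq_su, rotZ_eq_su, rotX_eq_su, su_mul_su, su_mul_su]
  simp only [h3, map_zero, mul_zero, zero_mul, sub_zero, add_zero, zero_add]
  congr 1
  · linear_combination (Real.cos θ : ℂ) * h1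
  · linear_combination (Complex.I * Real.sin θ : ℂ) * h2

/-- The phase that cancels the leading coefficients in the layer stripping step. -/
theorem exists_phase_mul_eq {p q : ℂ} (h : p * conj p = q * conj q) :
    ∃ α : ℝ, conj (Complex.exp (α * Complex.I)) * p = Complex.exp (α * Complex.I) * q := by
  have hpq : ‖p‖ = ‖q‖ := by
    rw [Complex.mul_conj, Complex.mul_conj, Complex.normSq_eq_norm_sq,
      Complex.normSq_eq_norm_sq] at h
    exact (sq_eq_sq₀ (norm_nonneg _) (norm_nonneg _)).1 (by exact_mod_cast h)
  by_cases hq : q = 0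
  · have hp : p = 0 := by rw [← norm_eq_zero, hpq, hq, norm_zero]
    exact ⟨0, by simp [hp, hq]⟩
  refine ⟨Complex.arg (p / q) / 2, ?_⟩
  set w := Complex.exp ((Complex.arg (p / q) / 2 : ℝ) * Complex.I) with hw
  have hww : w * w = p / q := by
    have := Complex.norm_mul_exp_arg_mul_I (p / q)
    rw [norm_div, hpq, div_self (norm_ne_zero_iff.2 hq), Complex.ofReal_one, one_mul] at this
    rw [← this, hw, ← Complex.exp_add]
    congr 1; push_cast; ring
  have hwc : conj w * w = 1 := by
    rw [← Complex.normSq_eq_conj_mul_self, Complex.normSq_eq_norm_sq, hw,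
      Complex.norm_exp_ofReal_mul_I]
    simp
  have hp : p = w * w * q := by rw [hww, div_mul_cancel₀ _ hq]
  rw [hp]
  linear_combination w * q * hwc

/-- Quantum signal processing: every pair of complementary polynomials of the right degrees and
parities is realised by a sequence of signal operators interleaved with `z`-rotations. -/
theorem exists_phases (n : ℕ) (P Q : ℂ[X]) (hP : ∀ k, P.coeff k ≠ 0 → ∃ j, k + 2 * j = n)
    (hQ : ∀ k, Q.coeff k ≠ 0 → ∃ j, k + 2 * j + 1 = n)
    (hPQ : P * P.map (starRingEnd ℂ) + (1 - X ^ 2) * (Q * Q.map (starRingEnd ℂ)) = 1) :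
    ∃ (a : ℝ) (l : List ℝ), l.length = n ∧ ∀ φ θ : ℝ,
      rotZ a * (l.map fun b => twisted φ θ * rotZ b).prod
        = su (P.eval (Real.cos θ : ℂ))
            (Complex.I * Real.sin θ * Q.eval (Real.cos θ : ℂ) * Complex.exp (φ * Complex.I)) := by
  induction n generalizing P Q with
  | zero =>
    have hQ0 : Q = 0 := by
      ext k
      by_contra h
      obtain ⟨j, hj⟩ := hQ k h
      omega
    have hP0 : P = C (P.coeff 0) := by
      ext k
      rw [coeff_C]
      split_ifs with hk
      · rw [hk]
      · by_contra h
        obtain ⟨j, hj⟩ := hP k h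
        omega
    set p := P.coeff 0
    have hp : p * conj p = 1 := by
      rw [hP0, hQ0] at hPQ
      simpa using congrArg (eval 0) hPQ
    have hp1 : ‖p‖ = 1 := by
      rw [Complex.mul_conj, Complex.normSq_eq_norm_sq] at hp
      exact (pow_eq_one_iff_of_nonneg (norm_nonneg _) two_ne_zero).1 (by exact_mod_cast hp)
    refine ⟨Complex.arg p, [], rfl, fun φ θ => ?_⟩
    have := Complex.norm_mul_exp_arg_mul_I p
    rw [hp1, Complex.ofReal_one, one_mul] at this
    rw [rotZ_eq_su, this, hP0, hQ0]
    simp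
  | succ n ih =>
    have hPd : P.natDegree ≤ n + 1 := natDegree_le_iff_coeff_eq_zero.2 fun k hk => by
      by_contra h
      obtain ⟨j, hj⟩ := hP k h
      omega
    have hQd : Q.natDegree ≤ n := natDegree_le_iff_coeff_eq_zero.2 fun k hk => by
      by_contra h
      obtain ⟨j, hj⟩ := hQ k h
      omega
    -- Coefficient of `X ^ (2n + 2)` in `hPQ`: the leading coefficients have equal modulus, so a
    -- phase can match them.
    have hlead : P.coeff (n + 1) * conj (P.coeff (n + 1)) = Q.coeff n * conj (Q.coeff n) := by
      have h := congrArg (fun R => coeff R ((n + 1) + (n + 1))) hPQ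
      have hQQ : (Q * Q.map (starRingEnd ℂ)).natDegree ≤ n + n :=
        natDegree_mul_le_of_le hQd (natDegree_map_le.trans hQd)
      have h2 : ((1 : ℂ[X]) - X ^ 2) * (Q * Q.map (starRingEnd ℂ))
          = Q * Q.map (starRingEnd ℂ) - X ^ 2 * (Q * Q.map (starRingEnd ℂ)) := by ring
      simp only [coeff_add, h2, coeff_sub] at h
      rw [coeff_mul_add_eq_of_natDegree_le hPd (natDegree_map_le.trans hPd),
        coeff_eq_zero_of_natDegree_lt (p := Q * Q.map (starRingEnd ℂ)) (by omega),
        show n + 1 + (n + 1) = (n + n) + 2 by ring, coeff_X_pow_mul,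
        coeff_mul_add_eq_of_natDegree_le hQd (natDegree_map_le.trans hQd), coeff_one,
        if_neg (by omega), coeff_map, coeff_map] at h
      linear_combination h
    obtain ⟨α, hα⟩ := exists_phase_mul_eq hlead
    set w := Complex.exp (α * Complex.I) with hw
    have hwc : conj w * w = 1 := by
      rw [← Complex.normSq_eq_conj_mul_self, Complex.normSq_eq_norm_sq, hw,
        Complex.norm_exp_ofReal_mul_I]
      simp
    have hPz : ∀ k, (∀ j, k + 2 * j ≠ n + 1) → P.coeff k = 0 := fun k hk => by
      by_contra h
      obtain ⟨j, hj⟩ := hP k h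
      exact hk j hj
    have hQz : ∀ k, (∀ j, k + 2 * j + 1 ≠ n + 1) → Q.coeff k = 0 := fun k hk => by
      by_contra h
      obtain ⟨j, hj⟩ := hQ k h
      exact hk j hj
    -- These are the entries after right multiplication by the inverse of `twisted φ θ * rotZ α`.
    -- The choice of `α` cancels both top coefficients, so both degree bounds drop by one; parity
    -- and complementarity persist.
    obtain ⟨a, l, hl, h⟩ := ih (C (conj w) * (X * P) + C w * (Q - X ^ 2 * Q))
      (C w * (X * Q) - C (conj w) * P) (fun k => by
        contrapose!
        intro hk
        simp only [coeff_add, coeff_C_mul, coeff_sub]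
        match k with
        | 0 => simp [hQz 0 fun j hj => hk j (by omega)]
        | 1 =>
          rw [show (1 : ℕ) = 0 + 1 from rfl, coeff_X_mul, coeff_X_pow_mul', if_neg (by omega),
            hPz 0 fun j hj => hk (j - 1) (by omega), hQz (0 + 1) fun j hj => hk j (by omega)]
          simp
        | k + 2 =>
          rw [coeff_X_pow_mul, show k + 2 = (k + 1) + 1 from rfl, coeff_X_mul,
            hQz (k + 1 + 1) fun j hj => hk j (by omega)]
          by_cases hkn : k = n
          · rw [hkn]
            linear_combination hα
          · rw [hPz (k + 1) fun j hj => hk (j - 1) (by omega),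
              hQz k fun j hj => hk (j - 1) (by omega)]
            simp) (fun k => by
        contrapose!
        intro hk
        simp only [coeff_C_mul, coeff_sub]
        match k with
        | 0 => simp [hPz 0 fun j hj => hk (j - 1) (by omega)]
        | k + 1 =>
          rw [coeff_X_mul]
          by_cases hkn : k = n
          · rw [hkn]
            linear_combination -hα
          · rw [hPz (k + 1) fun j hj => hk (j - 1) (by omega),
              hQz k fun j hj => hk (j - 1) (by omega)]
            simp) (by
        have hC : (C (conj w) : ℂ[X]) * C w = 1 := by rw [← C_mul, hwc, C_1]
        simp only [Polynomial.map_add, Polynomial.map_sub, Polynomial.map_mul, Polynomial.map_pow,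
          map_X, map_C, Complex.conj_conj]
        linear_combination hPQ + (P * P.map (starRingEnd ℂ)
          + (1 - X ^ 2) * (Q * Q.map (starRingEnd ℂ))) * hC)
    refine ⟨a, l ++ [α], by simp [hl], fun φ θ => ?_⟩
    rw [List.map_append, List.prod_append, ← mul_assoc, h, List.map_singleton, List.prod_singleton,
      twisted_eq_su, rotZ_eq_su, ← hw, su_mul_su, su_mul_su]
    have hz : conj (Complex.exp (φ * Complex.I)) * Complex.exp (φ * Complex.I) = 1 := by
      rw [← Complex.normSq_eq_conj_mul_self, Complex.normSq_eq_norm_sq,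
        Complex.norm_exp_ofReal_mul_I]
      simp
    have hcs : (Real.cos θ : ℂ) ^ 2 + (Real.sin θ : ℂ) ^ 2 = 1 := by
      exact_mod_cast Real.cos_sq_add_sin_sq θ
    set z := Complex.exp (φ * Complex.I)
    set c := (Real.cos θ : ℂ)
    set s := (Real.sin θ : ℂ)
    have hc : conj c = c := Complex.conj_ofReal _
    have hs : conj s = s := Complex.conj_ofReal _
    simp only [eval_add, eval_sub, eval_mul, eval_C, eval_X, eval_pow, map_mul, map_zero, hc, hs,
      Complex.conj_I, Complex.conj_conj, mul_zero, sub_zero, zero_add]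
    set p := P.eval c
    set q := Q.eval c
    congr 1
    · linear_combination
        (Complex.I ^ 2 * s ^ 2 * (w * (c * q) - conj w * p) * w) * hz
          + (s ^ 2 * (w * (c * q) - conj w * p) * w) * Complex.I_sq
          + (w * conj w * p - w ^ 2 * c * q) * hcs + p * hwc
    · linear_combination (Complex.I * s * q * z) * hwc

end QCircuit

/-! ### Signal processing in the variable `sin 2θ` -/

namespace QCircuit

open ComplexConjugate

/-- A real polynomial whose odd extension is bounded by `1` on `[0, 1]` is realised, in the
variable `sin (2 * θ)`, as the off-diagonal entry of a signal processing sequence. -/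
theorem exists_phases_sin_two_mul {k : ℕ} (g : ℝ[X]) (hgd : g.natDegree ≤ k)
    (hg : ∀ s : ℝ, 0 ≤ s → s ≤ 1 → 0 ≤ s * g.eval (s ^ 2) ∧ s * g.eval (s ^ 2) ≤ 1) :
    ∃ (a : ℝ) (l : List ℝ) (p : ℝ → ℂ), l.length = 2 * (2 * k + 1) ∧ ∀ θ : ℝ,
      Complex.normSq (p θ) + (Real.sin (2 * θ) * g.eval (Real.sin (2 * θ) ^ 2)) ^ 2 = 1 ∧
      ∀ φ : ℝ, rotZ a * (l.map fun b => twisted φ θ * rotZ b).prod = su (p θ)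
        (Complex.I * (Real.sin (2 * θ) * g.eval (Real.sin (2 * θ) ^ 2) : ℝ)
          * Complex.exp (φ * Complex.I)) := by
  -- With `u = cos² θ` one has `sin² 2θ = 4u(1 - u)`, and the `2` comes from `sin 2θ = 2 sin θ cos
  -- θ`. Working in `u` makes `B` nonnegative on the whole line, and substituting `X²` afterwards
  -- yields the required parity.
  set r : ℝ[X] := C 2 * g.comp (C 4 * X * (1 - X)) with hr
  set B : ℝ[X] := 1 - X * (1 - X) * r ^ 2 with hB
  have hre (u : ℝ) : r.eval u = 2 * g.eval (4 * u * (1 - u)) := by simp [hr, eval_comp]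
  have hBe (u : ℝ) : B.eval u = 1 - 4 * u * (1 - u) * (g.eval (4 * u * (1 - u))) ^ 2 := by
    simp only [hB, eval_sub, eval_one, eval_mul, eval_X, eval_pow, hre]
    ring
  have hB0 (u : ℝ) : 0 ≤ B.eval u := by
    rw [hBe]
    have hv1 : 4 * u * (1 - u) ≤ 1 := by nlinarith [sq_nonneg (2 * u - 1)]
    set v := 4 * u * (1 - u)
    -- For `v ≤ 0` the subtracted term is nonpositive; for `0 ≤ v ≤ 1` the bound on `g` applies at
    -- `s = √v`.
    rcases le_total v 0 with hv | hv
    · nlinarith [mul_nonneg (neg_nonneg.2 hv) (sq_nonneg (g.eval v))]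
    · obtain ⟨h1, h2⟩ := hg (Real.sqrt v) (Real.sqrt_nonneg v) (Real.sqrt_le_one.2 hv1)
      rw [Real.sq_sqrt hv] at h1 h2
      have := pow_le_one₀ (n := 2) h1 h2
      rw [mul_pow, Real.sq_sqrt hv] at this
      linarith
  have hrd : r.natDegree ≤ 2 * k := by
    rw [hr]
    refine (natDegree_C_mul_le _ _).trans ?_
    rw [natDegree_comp]
    have : (C 4 * X * (1 - X) : ℝ[X]).natDegree ≤ 2 := by compute_degree
    nlinarith
  have hBd : B.natDegree ≤ 2 * (2 * k + 1) := by
    rw [hB]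
    refine (natDegree_sub_le _ _).trans (max_le (by simp) ?_)
    have h1 : (X * (1 - X) : ℝ[X]).natDegree ≤ 2 := by compute_degree
    have h2 : (r ^ 2).natDegree ≤ 2 * (2 * k) := natDegree_pow_le_of_le 2 hrd
    exact (natDegree_mul_le_of_le h1 h2).trans (by omega)
  obtain ⟨P₀, hP₀⟩ := exists_map_eq_mul_map_conj B hB0
  have hP₀d : P₀.natDegree ≤ 2 * k + 1 := by
    by_cases h0 : P₀ = 0
    · simp [h0]
    have h := congrArg natDegree hP₀
    rw [natDegree_mul h0 ((Polynomial.map_ne_zero_iff (RingHom.injective _)).2 h0), natDegree_map,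
      natDegree_map] at h
    omega
  set R : ℂ[X] := expand ℂ 2 (r.map Complex.ofRealHom) with hR
  have hRconj : R.map (starRingEnd ℂ) = R := by
    rw [hR, map_expand, Polynomial.map_map]
    congr 2
    ext x
    simp
  set P : ℂ[X] := expand ℂ 2 P₀ with hP
  have hPQ : P * P.map (starRingEnd ℂ)
      + (1 - X ^ 2) * ((X * R) * (X * R).map (starRingEnd ℂ)) = 1 := by
    have h := congrArg (expand ℂ 2) hP₀
    rw [map_mul, ← hP, hB] at h
    simp only [Polynomial.map_sub, Polynomial.map_one, Polynomial.map_mul, map_X,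
      Polynomial.map_pow, map_sub, map_one, map_mul, map_pow, expand_X, ← hR] at h
    rw [Polynomial.map_mul, map_X, hRconj, hP, map_expand, ← hP]
    linear_combination -h
  obtain ⟨a, l, hl, h⟩ := exists_phases (2 * (2 * k + 1)) P (X * R) (fun i hi => by
      rw [hP, coeff_expand two_pos] at hi
      split_ifs at hi with h2
      · have := le_natDegree_of_ne_zero hi
        exact ⟨2 * k + 1 - i / 2, by omega⟩
      · exact absurd rfl hi) (fun i hi => by
      match i with
      | 0 => simp at hi
      | i + 1 =>
        rw [coeff_X_mul, hR, coeff_expand two_pos] at hi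
        split_ifs at hi with h2
        · have := (le_natDegree_of_ne_zero hi).trans (natDegree_map_le.trans hrd)
          exact ⟨2 * k - i / 2, by omega⟩
        · exact absurd rfl hi) hPQ
  have hQe (θ : ℝ) : (Real.sin θ : ℂ) * (X * R).eval (Real.cos θ : ℂ)
      = (Real.sin (2 * θ) * g.eval (Real.sin (2 * θ) ^ 2) : ℝ) := by
    have h1 : R.eval (Real.cos θ : ℂ) = ((r.eval (Real.cos θ ^ 2) : ℝ) : ℂ) := by
      rw [hR, expand_eval, ← Complex.ofReal_pow]
      exact eval_map_apply Complex.ofRealHom _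
    have h2 : Real.sin (2 * θ) ^ 2 = 4 * Real.cos θ ^ 2 * (1 - Real.cos θ ^ 2) := by
      rw [Real.sin_two_mul, ← Real.sin_sq]; ring
    rw [eval_mul, eval_X, h1, hre, h2, Real.sin_two_mul]
    push_cast
    ring
  refine ⟨a, l, fun θ => P.eval (Real.cos θ : ℂ), hl, fun θ => ⟨?_, fun φ => ?_⟩⟩
  · have hc (S : ℂ[X]) : (S.map (starRingEnd ℂ)).eval (Real.cos θ : ℂ)
        = conj (S.eval (Real.cos θ : ℂ)) := by
      conv_lhs => rw [← Complex.conj_ofReal (Real.cos θ)]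
      exact eval_map_apply _ _
    have he := congrArg (eval (Real.cos θ : ℂ)) hPQ
    rw [eval_add, eval_mul, eval_mul, eval_mul, hc, hc, Complex.mul_conj] at he
    have hs : (1 - X ^ 2 : ℂ[X]).eval (Real.cos θ : ℂ) = Real.sin θ * conj (Real.sin θ : ℂ) := by
      rw [Complex.conj_ofReal, ← sq, ← Complex.ofReal_pow, Real.sin_sq]
      simp
    have h3 : (Real.sin θ * conj (Real.sin θ : ℂ)) * ((X * R).eval (Real.cos θ : ℂ)
          * conj ((X * R).eval (Real.cos θ : ℂ)))
        = ((Real.sin θ : ℂ) * (X * R).eval (Real.cos θ : ℂ))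
          * conj ((Real.sin θ : ℂ) * (X * R).eval (Real.cos θ : ℂ)) := by
      rw [map_mul]; ring
    rw [hs, h3, hQe, Complex.conj_ofReal, eval_one, ← sq] at he
    exact_mod_cast he
  · rw [h, mul_assoc Complex.I, hQe]

end QCircuit

/-! ### Controlled circuits, error and query bounds -/

namespace QCircuit

open ComplexConjugate

/-- The operator acting on `t₁` as `A` if `c` is `0` and as `B` if `c` is `1`. -/
def select (A B : Matrix (Fin 2) (Fin 2) ℂ) : Op3 :=
  Matrix.single (0 : Fin 2) 0 1 ⊗ₖ (A ⊗ₖ (1 : Matrix (Fin 2) (Fin 2) ℂ))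
    + Matrix.single (1 : Fin 2) 1 1 ⊗ₖ (B ⊗ₖ (1 : Matrix (Fin 2) (Fin 2) ℂ))

theorem select_mul_select (A B A' B' : Matrix (Fin 2) (Fin 2) ℂ) :
    select A B * select A' B' = select (A * A') (B * B') := by
  simp [select, mul_add, add_mul, ← Matrix.mul_kronecker_mul]

theorem single_zero_add_single_one :
    Matrix.single (0 : Fin 2) 0 (1 : ℂ) + Matrix.single (1 : Fin 2) (1 : Fin 2) 1 = 1 := by
  ext i j
  fin_cases i <;> fin_cases j <;> simp [Matrix.single]

theorem onQubit_t₁_eq_select (A : Matrix (Fin 2) (Fin 2) ℂ) : onQubit .t₁ A = select A A := by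
  rw [select, ← Matrix.add_kronecker, single_zero_add_single_one, onQubit]

theorem controlled_t₁_eq_select (A : Matrix (Fin 2) (Fin 2) ℂ) :
    controlled .t₁ A = select 1 A := by
  simp [controlled, projC, Target.toQubit, onQubit, select, ← Matrix.mul_kronecker_mul]

theorem select_one_one : select 1 1 = 1 := by
  rw [← onQubit_t₁_eq_select, onQubit, Matrix.one_kronecker_one, Matrix.one_kronecker_one]

theorem select_sub_select (A B B' : Matrix (Fin 2) (Fin 2) ℂ) :
    select A B - select A B' = select 0 (B - B') := by
  rw [sub_eq_iff_eq_add]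
  simp [select, add_left_comm, ← Matrix.kronecker_add, ← Matrix.add_kronecker]

theorem star_select_zero (B : Matrix (Fin 2) (Fin 2) ℂ) :
    star (select 0 B) = select 0 (star B) := by
  simp [select, Matrix.star_eq_conjTranspose, Matrix.conjTranspose_kronecker]

theorem select_zero_smul (a : ℂ) (B : Matrix (Fin 2) (Fin 2) ℂ) :
    select 0 (a • B) = a • select 0 B := by
  simp [select, Matrix.smul_kronecker, Matrix.kronecker_smul]

theorem opNorm_sq (A : Op3) : opNorm A ^ 2 = opNorm (star A * A) := by
  rw [opNorm, opNorm, map_mul, map_star, sq]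
  exact (ContinuousLinearMap.norm_adjoint_comp_self _).symm

theorem star_su_mul_su (a b : ℂ) :
    star (su a b) * su a b = ((Complex.normSq a + Complex.normSq b : ℝ) : ℂ) • 1 := by
  ext i j
  fin_cases i <;> fin_cases j <;>
    simp [su, Matrix.mul_apply, Fin.sum_univ_two, Complex.normSq_eq_conj_mul_self] <;> ring

/-- `select 0 1` is a self-adjoint projection, so the C*-identity says that its norm equals its own
square. -/
theorem opNorm_select_zero_one_le : opNorm (select 0 1) ≤ 1 := by
  have h := opNorm_sq (select 0 1)
  rw [star_select_zero, star_one, select_mul_select, mul_zero, mul_one] at h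
  nlinarith

theorem opNorm_select_zero_su_le (a b : ℂ) :
    opNorm (select 0 (su a b)) ^ 2 ≤ Complex.normSq a + Complex.normSq b := by
  have h0 : 0 ≤ Complex.normSq a + Complex.normSq b :=
    add_nonneg (Complex.normSq_nonneg a) (Complex.normSq_nonneg b)
  rw [opNorm_sq, star_select_zero, select_mul_select, mul_zero, star_su_mul_su, select_zero_smul,
    opNorm, map_smul, norm_smul, Complex.norm_real, Real.norm_of_nonneg h0]
  exact mul_le_of_le_one_right h0 opNorm_select_zero_one_le

theorem su_mem_unitaryGroup {a b : ℂ} (h : Complex.normSq a + Complex.normSq b = 1) :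
    su a b ∈ Matrix.unitaryGroup (Fin 2) ℂ := by
  rw [Matrix.mem_unitaryGroup_iff', star_su_mul_su, h, Complex.ofReal_one, one_smul]

theorem rotZ_mem_unitaryGroup (t : ℝ) : rotZ t ∈ Matrix.unitaryGroup (Fin 2) ℂ := by
  rw [rotZ_eq_su]
  apply su_mem_unitaryGroup
  rw [Complex.normSq_eq_norm_sq, Complex.norm_exp_ofReal_mul_I]
  simp

theorem sigmaZ_mul_sigmaZ : sigmaZ * sigmaZ = 1 := by
  ext i j
  fin_cases i <;> fin_cases j <;> simp [sigmaZ, Matrix.mul_apply, Fin.sum_univ_two]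

theorem sigmaZ_mem_unitaryGroup : sigmaZ ∈ Matrix.unitaryGroup (Fin 2) ℂ := by
  rw [Matrix.mem_unitaryGroup_iff']
  have : star sigmaZ = sigmaZ := by
    ext i j
    fin_cases i <;> fin_cases j <;> simp [sigmaZ]
  rw [this, sigmaZ_mul_sigmaZ]

/-- Conjugation by `σ_z` negates the off-diagonal entries, which inverts the oracle because its
diagonal is real. -/
theorem twisted_mul_sigmaZ_sq (φ θ : ℝ) : (twisted φ θ * sigmaZ) ^ 2 = 1 := by
  have hz : sigmaZ * twisted φ θ * sigmaZ = star (twisted φ θ) := by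
    rw [twisted_eq_su]
    ext i j
    fin_cases i <;> fin_cases j <;>
      simp [su, sigmaZ, Matrix.mul_apply, Fin.sum_univ_two, -Complex.ofReal_cos,
        -Complex.ofReal_sin]
  have hu : twisted φ θ ∈ Matrix.unitaryGroup (Fin 2) ℂ := by
    rw [twisted_eq_su]
    apply su_mem_unitaryGroup
    rw [map_mul, map_mul, Complex.normSq_I, Complex.normSq_ofReal, Complex.normSq_ofReal,
      Complex.normSq_eq_norm_sq (Complex.exp _), Complex.norm_exp_ofReal_mul_I]
    nlinarith [Real.sin_sq_add_cos_sq θ]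
  rw [sq, mul_assoc, ← mul_assoc sigmaZ, hz, Matrix.mem_unitaryGroup_iff.1 hu]

/-- The gates that apply `U * rotZ b` to `t₁` if `c` is `1`, and `U * sigmaZ` otherwise. -/
noncomputable def layer (b : ℝ) : Circuit :=
  [.query .t₁, .fixed .t₁ ⟨sigmaZ, sigmaZ_mem_unitaryGroup⟩,
    -- The extra `σ_z` cancels the uncontrolled one when `c` is `1`.
    .ctrlFixed .t₁ (⟨sigmaZ, sigmaZ_mem_unitaryGroup⟩ * ⟨rotZ b, rotZ_mem_unitaryGroup b⟩)]

theorem eval_flatMap_layer (U : Matrix (Fin 2) (Fin 2) ℂ) (l : List ℝ) :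
    Circuit.eval U (l.flatMap layer)
      = select ((U * sigmaZ) ^ l.length) (l.map fun b => U * rotZ b).prod := by
  induction l with
  | nil => simp [Circuit.eval, select_one_one]
  | cons b l ih =>
    rw [Circuit.eval] at ih ⊢
    rw [List.flatMap_cons, List.map_append, List.prod_append, ih]
    simp only [layer, List.map_cons, List.map_nil, List.prod_cons, List.prod_nil, mul_one,
      Gate.eval, onQubit_t₁_eq_select, controlled_t₁_eq_select, select_mul_select,
      List.length_cons, pow_succ', Submonoid.coe_mul]
    rw [← mul_assoc sigmaZ sigmaZ, sigmaZ_mul_sigmaZ, one_mul]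

theorem queries_flatMap_layer (l : List ℝ) : Circuit.queries (l.flatMap layer) = l.length := by
  induction l with
  | nil => rfl
  | cons b l ih =>
    rw [Circuit.queries] at ih ⊢
    rw [List.flatMap_cons, List.map_append, List.sum_append, ih]
    simp [layer, Gate.queries, add_comm]

theorem normSq_zero_add_neg_I : Complex.normSq 0 + Complex.normSq (-Complex.I) = 1 := by simp

/-- The circuit that runs a signal processing sequence, followed by a flip, on `t₁` if `c` is
`1`. -/
noncomputable def controlledSequence (a : ℝ) (l : List ℝ) : Circuit :=
  .ctrlFixed .t₁ (⟨su 0 (-Complex.I), su_mem_unitaryGroup normSq_zero_add_neg_I⟩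
    * ⟨rotZ a, rotZ_mem_unitaryGroup a⟩) :: l.flatMap layer

theorem queries_controlledSequence (a : ℝ) (l : List ℝ) :
    Circuit.queries (controlledSequence a l) = l.length := by
  rw [← queries_flatMap_layer l, controlledSequence, Circuit.queries, Circuit.queries,
    List.map_cons, List.sum_cons, Gate.queries, zero_add]

theorem eval_controlledSequence (φ θ a : ℝ) {l : List ℝ} (hl : Even l.length) :
    Circuit.eval (twisted φ θ) (controlledSequence a l)
      = select 1 (su 0 (-Complex.I) * (rotZ a * (l.map fun b => twisted φ θ * rotZ b).prod)) := by
  obtain ⟨N, hN⟩ := hl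
  have h := eval_flatMap_layer (twisted φ θ) l
  rw [hN, ← two_mul, pow_mul, twisted_mul_sigmaZ_sq, one_pow] at h
  rw [Circuit.eval] at h ⊢
  rw [controlledSequence, List.map_cons, List.prod_cons, h, Gate.eval, controlled_t₁_eq_select,
    select_mul_select, mul_one, Submonoid.coe_mul, mul_assoc]

/-- The error lives in the branch `c = 1` and is a matrix `su a b`, whose squared norm is at most
`|a|² + |b|² = (1 - F)² + (1 - F²) = 2(1 - F)`. -/
theorem opNorm_eval_controlledSequence_sub_le {φ θ a F : ℝ} {p : ℂ} {l : List ℝ}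
    (hl : Even l.length) (hF : Complex.normSq p + F ^ 2 = 1)
    (h : rotZ a * (l.map fun b => twisted φ θ * rotZ b).prod
      = su p (Complex.I * F * Complex.exp (φ * Complex.I))) :
    opNorm (Circuit.eval (twisted φ θ) (controlledSequence a l)
      - controlled .t₁ (rotZ (-φ))) ^ 2 ≤ 2 * (1 - F) := by
  have hz : conj (Complex.exp (φ * Complex.I)) = Complex.exp ((-φ : ℝ) * Complex.I) := by
    rw [← Complex.exp_conj, map_mul, Complex.conj_ofReal, Complex.conj_I]
    congr 1; push_cast; ring
  have hd : su 0 (-Complex.I) * su p (Complex.I * F * Complex.exp (φ * Complex.I)) - rotZ (-φ)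
      = su ((F - 1 : ℝ) * Complex.exp ((-φ : ℝ) * Complex.I)) (-Complex.I * conj p) := by
    rw [su_mul_su, rotZ_eq_su, map_mul, map_mul, hz, Complex.conj_I, Complex.conj_ofReal]
    have h1 : 0 * p - -Complex.I * (-Complex.I * F * Complex.exp ((-φ : ℝ) * Complex.I))
        = F * Complex.exp ((-φ : ℝ) * Complex.I) := by
      linear_combination (-(F : ℂ) * Complex.exp ((-φ : ℝ) * Complex.I)) * Complex.I_sq
    rw [h1, zero_mul, zero_add, Complex.ofReal_sub, Complex.ofReal_one, sub_mul, one_mul]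
    ext i j
    fin_cases i <;> fin_cases j <;> simp [su]
  rw [eval_controlledSequence φ θ a hl, controlled_t₁_eq_select, select_sub_select, h, hd]
  refine (opNorm_select_zero_su_le _ _).trans (le_of_eq ?_)
  rw [map_mul, map_mul, Complex.normSq_ofReal, Complex.normSq_eq_norm_sq (Complex.exp _),
    Complex.norm_exp_ofReal_mul_I, Complex.normSq_neg, Complex.normSq_I, Complex.normSq_conj]
  linear_combination hF

/-- In `2x√(1 - x²)`, one of `x` and `√(1 - x²)` is at least `1/2` and the other at least `δ`. -/
theorem le_sin_two_mul_arccos {δ x : ℝ} (hδ : 0 < δ) (hx : x ∈ Set.Icc δ (1 - δ)) :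
    δ ≤ Real.sin (2 * Real.arccos x) := by
  obtain ⟨h1, h2⟩ := hx
  rw [Real.sin_two_mul, Real.sin_arccos, Real.cos_arccos (by linarith) (by linarith)]
  rcases le_total x (1 / 2) with h | h
  · have : 1 / 2 ≤ Real.sqrt (1 - x ^ 2) := Real.le_sqrt_of_sq_le (by nlinarith)
    nlinarith
  · have : δ ≤ Real.sqrt (1 - x ^ 2) := Real.le_sqrt_of_sq_le (by nlinarith)
    nlinarith

theorem exists_controlledSequence {δ ε : ℝ} (m : ℕ) (hδ : 0 < δ) (hδ1 : δ ≤ 1 / 2) (hε : 0 < ε)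
    (hm : 16 ≤ Real.exp (2 * m * δ) * (δ * ε ^ 2)) :
    ∃ P : Circuit, Circuit.queries P = 8 * m + 2 ∧
      ∀ φ x : ℝ, x ∈ Set.Icc δ (1 - δ) →
        opNorm (Circuit.eval (twisted φ (Real.arccos x)) P - controlled .t₁ (rotZ (-φ))) ≤ ε := by
  -- The squared error is at most `2η`, hence `η = ε² / 2`. The degree bound `k = 2m` gives `2(2k +
  -- 1) = 8m + 2` queries.
  obtain ⟨g, hgd, hg, hgδ⟩ := exists_odd_sign_approx m (η := ε ^ 2 / 2) hδ hδ1
    (by linarith) (by positivity)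
  obtain ⟨a, l, p, hl, h⟩ := exists_phases_sin_two_mul g hgd hg
  refine ⟨controlledSequence a l, ?_, fun φ x hx => ?_⟩
  · rw [queries_controlledSequence, hl]; ring
  · obtain ⟨hp, hφ⟩ := h (Real.arccos x)
    have hle := opNorm_eval_controlledSequence_sub_le (hl ▸ even_two_mul _) hp (hφ φ)
    have hF := hgδ _ (le_sin_two_mul_arccos hδ hx) (Real.sin_le_one _)
    exact le_of_sq_le_sq (hle.trans (by linarith)) hε.le

theorem exists_nat_mul_exp_ge {δ ε : ℝ} (hδ : 0 < δ) (hδ1 : δ ≤ 1 / 2) (hε : 0 < ε)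
    (hε1 : ε ≤ 1) :
    ∃ m : ℕ, 16 ≤ Real.exp (2 * m * δ) * (δ * ε ^ 2) ∧
      (8 * m + 2 : ℝ) ≤ 34 * (δ⁻¹ * Real.log (1 / (ε * δ))) := by
  set Λ := Real.log (1 / (ε * δ)) with hΛ
  have hd2 : 2 ≤ δ⁻¹ := by rw [le_inv_comm₀ two_pos hδ]; linarith
  have hlog2 : Real.log 2 ≤ Λ := by
    apply Real.log_le_log two_pos
    rw [le_div_iff₀ (by positivity)]
    nlinarith
  have hhalf : 1 / 2 ≤ Λ := by have := Real.log_two_gt_d9; linarith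
  -- Then `2mδ ≥ 6Λ`: the part `4Λ ≥ 4 log 2` supplies the `16`, and `e^{2Λ} = (εδ)⁻²` absorbs
  -- `δε²`. The count is at most `24L + 10 ≤ 34L` for `L = δ⁻¹Λ ≥ 1`.
  refine ⟨⌈3 * (δ⁻¹ * Λ)⌉₊, ?_, ?_⟩
  · have h1 : 6 * Λ ≤ 2 * (⌈3 * (δ⁻¹ * Λ)⌉₊ : ℝ) * δ := by
      calc 6 * Λ = 2 * (3 * (δ⁻¹ * Λ)) * δ := by field_simp; ring
        _ ≤ _ := by gcongr; exact Nat.le_ceil _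
    have h2 : 16 * (1 / (ε * δ)) ^ 2 ≤ Real.exp (6 * Λ) := by
      rw [show 6 * Λ = 4 * Λ + 2 * Λ by ring, Real.exp_add]
      have h3 : Real.exp (2 * Λ) = (1 / (ε * δ)) ^ 2 := by
        rw [← Nat.cast_two, Real.exp_nat_mul, hΛ, Real.exp_log (by positivity)]
      have h4 : (16 : ℝ) ≤ Real.exp (4 * Λ) := by
        calc (16 : ℝ) = Real.exp (4 * Real.log 2) := by
              rw [show (4 : ℝ) = (4 : ℕ) by norm_num, Real.exp_nat_mul, Real.exp_log two_pos]
              norm_num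
          _ ≤ _ := by gcongr
      rw [h3]
      gcongr
    calc (16 : ℝ) ≤ 16 * δ⁻¹ := by linarith
      _ = 16 * (1 / (ε * δ)) ^ 2 * (δ * ε ^ 2) := by field_simp
      _ ≤ _ := by
        gcongr
        exact h2.trans (Real.exp_le_exp.2 h1)
  · have h1 : (⌈3 * (δ⁻¹ * Λ)⌉₊ : ℝ) ≤ 3 * (δ⁻¹ * Λ) + 1 := (Nat.ceil_lt_add_one (by positivity)).le
    have h2 : 1 ≤ δ⁻¹ * Λ := by nlinarith
    linarith

end QCircuit

theorem mainTheorem10 :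
    ∃ C : ℝ, 0 < C ∧
      ∀ δ ε : ℝ, 0 < δ → δ ≤ 1 → 0 < ε → ε ≤ 1 →
        ∃ P : QCircuit.Circuit,
          (QCircuit.Circuit.queries P : ℝ) ≤ C * (δ⁻¹ * Real.log (1 / (ε * δ))) ∧
          ∀ φ x : ℝ, x ∈ Set.Icc δ (1 - δ) →
            QCircuit.opNorm
              (QCircuit.Circuit.eval (QCircuit.twisted φ (Real.arccos x)) P
                - QCircuit.controlled QCircuit.Target.t₁ (QCircuit.rotZ (-φ))) ≤ ε := by
  refine ⟨34, by norm_num, fun δ ε hδ hδ1 hε hε1 => ?_⟩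
  rcases le_or_gt δ (1 / 2) with hδ2 | hδ2
  · obtain ⟨m, hm, hle⟩ := QCircuit.exists_nat_mul_exp_ge hδ hδ2 hε hε1
    obtain ⟨P, hP, h⟩ := QCircuit.exists_controlledSequence m hδ hδ2 hε hm
    exact ⟨P, by rw [hP]; exact_mod_cast hle, h⟩
  -- For `δ > 1/2` the interval `[δ, 1 - δ]` is empty.
  · refine ⟨[], ?_, fun φ x hx => absurd (hx.1.trans hx.2) (by linarith)⟩
    have : 0 ≤ Real.log (1 / (ε * δ)) :=
      Real.log_nonneg (by rw [le_div_iff₀ (by positivity)]; nlinarith)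
    simp only [QCircuit.Circuit.queries, List.map_nil, List.sum_nil, Nat.cast_zero]
    positivity
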